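/- Let $\alpha=(\alpha_1,\ldots,\alpha_s)$ be a composition of $n$, i.e. a finite sequence of positive integers with sum $n$ (for $n=0$ the empty composition is allowed). The fence poset $F(\alpha)$ is the poset on the $n+1$ nodes $x_1,\ldots,x_{n+1}$ whose order is the reflexive transitive closure of the relations $$x_1\preceq x_2\preceq\cdots\preceq x_{\alpha_1+1}\succeq x_{\alpha_1+2}\succeq\cdots\succeq x_{\alpha_1+\alpha_2+1}\preceq x_{\alpha_1+\alpha_2+2}\preceq\cdots\preceq x_{\alpha_1+\alpha_2+\alpha_3+1}\succeq\cdots,$$ going up along the odd-numbered parts of $\alpha$ and down along the even-numbered parts. Let $J(\alpha)$ be the distributive lattice of lower order ideals of $F(\alpha)$, ranked by the size of the ideals, and let $$R(\alpha;q)=\sum_{I\in J(\alpha)}q^{|I|}=\sum_{k=0}^{n+1}r_k q^k$$ be its rank polynomial. **Theorem.** For every composition $\alpha$ the rank polynomial $R(\alpha;q)$ is unimodal: there is an index $m\in\{0,\ldots,n+1\}$ with $$r_0\le r_1\le\cdots\le r_m\ge r_{m+1}\ge\cdots\ge r_{n+1}.$$ -/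

import Mathlib

/-- The underlying set `{x_1, …, x_{n+1}}` of the fence poset of a composition `α` of `n`;
the node `x_{j+1}` is the element `j` of `Fin (n + 1)`. -/
def Fence {n : ℕ} (_α : Composition n) : Type := Fin (n + 1)

namespace Fence

variable {n : ℕ} {α : Composition n}

instance : Finite (Fence α) := inferInstanceAs (Finite (Fin (n + 1)))

/-- The node `x_{j+1}`. -/
def node (α : Composition n) (j : Fin (n + 1)) : Fence α := j

/-- The defining relations of the fence, between consecutive nodes. The `i`-th edge (counted from
`0`) joins `x_{i+1}` and `x_{i+2}` and lies in the segment with index `α.index i` (counted from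
`0`). It goes up in the 1st, 3rd, 5th, … segment and down in the 2nd, 4th, 6th, … segment. -/
inductive Step (α : Composition n) : Fence α → Fence α → Prop
  | up (i : Fin n) (h : Even (α.index i : ℕ)) : Step α (node α i.castSucc) (node α i.succ)
  | down (i : Fin n) (h : Odd (α.index i : ℕ)) : Step α (node α i.succ) (node α i.castSucc)

/-- Auxiliary height function (number of up edges minus number of down edges to the left of a
node), used only to see that the order is antisymmetric. -/
def height (α : Composition n) (x : Fence α) : ℤ :=
  ∑ i : Fin n, if i.val < Fin.val (n := n + 1) x then
    (if Even (α.index i : ℕ) then (1 : ℤ) else -1) else 0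

theorem height_succ (i : Fin n) :
    height α (node α i.succ) = height α (node α i.castSucc) +
      (if Even (α.index i : ℕ) then (1 : ℤ) else -1) := by
  have key : ∀ j : Fin n, (if j.val < i.val + 1 then
      (if Even (α.index j : ℕ) then (1 : ℤ) else -1) else 0) =
      (if j.val < i.val then (if Even (α.index j : ℕ) then (1 : ℤ) else -1) else 0) +
      (if j = i then (if Even (α.index j : ℕ) then (1 : ℤ) else -1) else 0) := by
    intro j
    rcases lt_trichotomy j.val i.val with h | h | h
    · have : j ≠ i := fun e => by simp [e] at h
      simp [h, this, Nat.lt_succ_of_lt h]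
    · have : j = i := Fin.ext h
      simp [this]
    · have h1 : j ≠ i := fun e => by simp [e] at h
      have h2 : ¬ j.val < i.val + 1 := by omega
      have h3 : ¬ j.val < i.val := by omega
      simp [h1, h2, h3]
  have total := Finset.sum_congr (rfl : (Finset.univ : Finset (Fin n)) = _) fun j _ => key j
  rw [Finset.sum_add_distrib, Finset.sum_ite_eq' Finset.univ i, if_pos (Finset.mem_univ i)]
    at total
  exact total

theorem height_lt_of_step {x y : Fence α} (h : Step α x y) : height α x < height α y := by
  cases h with
  | up i h => rw [height_succ, if_pos h]; omega
  | down i h => rw [height_succ, if_neg (Nat.not_even_iff_odd.mpr h)]; omega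

theorem eq_or_height_lt {x y : Fence α} (h : Relation.ReflTransGen (Step α) x y) :
    x = y ∨ height α x < height α y := by
  induction h with
  | refl => exact Or.inl rfl
  | tail _ hs ih =>
    have := height_lt_of_step hs
    rcases ih with rfl | ih
    · exact Or.inr this
    · exact Or.inr (ih.trans this)

/-- The fence poset `F(α)`: the order is the reflexive transitive closure of the defining
relations. -/
instance : PartialOrder (Fence α) where
  le := Relation.ReflTransGen (Step α)
  le_refl _ := Relation.ReflTransGen.refl
  le_trans _ _ _ := Relation.ReflTransGen.trans
  le_antisymm x y hxy hyx := by
    rcases eq_or_height_lt hxy with h | h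
    · exact h
    · rcases eq_or_height_lt hyx with h' | h'
      · exact h'.symm
      · exact absurd (h.trans h') (lt_irrefl _)

end Fence

instance LowerSet.finite_of_finite {P : Type*} [LE P] [Finite P] : Finite (LowerSet P) :=
  Finite.of_injective (fun I : LowerSet P => (I : Set P)) SetLike.coe_injective

noncomputable instance LowerSet.fintypeOfFinite {P : Type*} [LE P] [Finite P] :
    Fintype (LowerSet P) := Fintype.ofFinite _

/-- The rank polynomial `∑_I q^{|I|}` of the distributive lattice of lower ideals of a finite
poset `P`. -/
noncomputable def rankPolynomial (P : Type*) [PartialOrder P] [Finite P] : Polynomial ℕ :=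
  ∑ I : LowerSet P, Polynomial.X ^ (I : Set P).ncard

/-- A polynomial `a_0 + a_1 q + ⋯ + a_d q^d` of degree `d` is unimodal if
`a_0 ≤ a_1 ≤ ⋯ ≤ a_m ≥ a_{m+1} ≥ ⋯ ≥ a_d` for some index `m`. -/
def Polynomial.IsUnimodal (p : Polynomial ℕ) : Prop :=
  ∃ m ≤ p.natDegree,
    (∀ i < m, p.coeff i ≤ p.coeff (i + 1)) ∧
    (∀ i, m ≤ i → i < p.natDegree → p.coeff (i + 1) ≤ p.coeff i)

open scoped LaurentPolynomial

/-! With `d = n + 1` nodes, the coefficients satisfy a zigzag chain such as `a_d ≤ a_0 ≤ a_{d-1} ≤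
a_1 ≤ ⋯`, or its mirror image; this is `Interlacing`, and it forces unimodality. The three links
compare `a_i` and `a_j` for `i + j` equal to `d - 1`, `d` and `d + 1`.

Each link comes from closing the fence to a circular one, whose rank polynomial is the trace of a
product of transfer matrices. That trace is palindromic: one matrix intertwines every transfer
matrix with `q` times its image under `q ↦ 1/q` (`isPalindromic_trace`). Joining the two ends
through a new top node, through a new bottom node, or by a single edge gives the sums `d + 1`, `d -
1` and `d`. The discrepancy between fence and circle counts ideals with prescribed end nodes.
Prescribing an end node forces a run of neighbours and leaves a shorter fence, so strong induction
on the length tells which way the discrepancy leans (`wordPoly_middle`, `interlacing_wordPoly`). -/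

namespace FenceWord

open LaurentPolynomial Matrix

/-! ### Interlacing of Laurent polynomials -/

/-- Among coefficients whose indices sum to `c`, the one with the smaller index dominates. -/
def LeftHeavy (c : ℤ) (p : ℤ[T;T⁻¹]) : Prop :=
  ∀ i j : ℤ, i + j = c → i ≤ j → p.coeff j ≤ p.coeff i

/-- Among coefficients whose indices sum to `c`, the one with the larger index dominates. -/
def RightHeavy (c : ℤ) (p : ℤ[T;T⁻¹]) : Prop :=
  ∀ i j : ℤ, i + j = c → i ≤ j → p.coeff i ≤ p.coeff j

/-- The coefficients are symmetric about `c / 2`. -/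
def IsPalindromic (c : ℤ) (p : ℤ[T;T⁻¹]) : Prop :=
  ∀ i j : ℤ, i + j = c → p.coeff i = p.coeff j

/-- The polynomial is top interlacing or bottom interlacing with respect to degree `d`. -/
structure Interlacing (d : ℤ) (p : ℤ[T;T⁻¹]) : Prop where
  left : LeftHeavy (d + 1) p
  right : RightHeavy (d - 1) p
  middle : LeftHeavy d p ∨ RightHeavy d p

variable {c d : ℤ} {p r : ℤ[T;T⁻¹]}

theorem coeff_T_mul (k i : ℤ) (p : ℤ[T;T⁻¹]) : (T k * p).coeff i = p.coeff (i - k) := by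
  rw [T, AddMonoidAlgebra.coeff_single_mul_apply, one_mul, neg_add_eq_sub]

theorem LeftHeavy.T_mul {k : ℤ} (h : LeftHeavy (c - 2 * k) p) : LeftHeavy c (T k * p) := by
  intro i j hij hle
  simp only [coeff_T_mul]
  exact h _ _ (by lia) (by lia)

theorem RightHeavy.T_mul {k : ℤ} (h : RightHeavy (c - 2 * k) p) : RightHeavy c (T k * p) := by
  intro i j hij hle
  simp only [coeff_T_mul]
  exact h _ _ (by lia) (by lia)

theorem RightHeavy.of_T_mul {k : ℤ} (h : RightHeavy (c + 2 * k) (T k * p)) :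
    RightHeavy c p := by
  intro i j hij hle
  have := h (i + k) (j + k) (by lia) (by lia)
  simpa only [coeff_T_mul, add_sub_cancel_right] using this

theorem IsPalindromic.leftHeavy_add (hp : IsPalindromic c p) (hr : LeftHeavy c r) :
    LeftHeavy c (p + r) := by
  intro i j hij hle
  have h1 := hp i j hij
  have h2 := hr i j hij hle
  simp only [AddMonoidAlgebra.coeff_add, Finsupp.add_apply]
  lia

theorem IsPalindromic.rightHeavy_add (hp : IsPalindromic c p) (hr : RightHeavy c r) :
    RightHeavy c (p + r) := by
  intro i j hij hle
  have h1 := hp i j hij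
  have h2 := hr i j hij hle
  simp only [AddMonoidAlgebra.coeff_add, Finsupp.add_apply]
  lia

theorem IsPalindromic.leftHeavy_of_add (h : IsPalindromic c (p + r)) (hr : RightHeavy c r) :
    LeftHeavy c p := by
  intro i j hij hle
  have h1 := h i j hij
  have h2 := hr i j hij hle
  simp only [AddMonoidAlgebra.coeff_add, Finsupp.add_apply] at h1
  lia

theorem IsPalindromic.rightHeavy_of_add (h : IsPalindromic c (p + r)) (hr : LeftHeavy c r) :
    RightHeavy c p := by
  intro i j hij hle
  have h1 := h i j hij
  have h2 := hr i j hij hle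
  simp only [AddMonoidAlgebra.coeff_add, Finsupp.add_apply] at h1
  lia

/-- An interlacing sequence is unimodal. -/
theorem Interlacing.exists_peak (h : Interlacing d p) :
    ∃ m : ℤ, d - 1 ≤ 2 * m ∧ MonotoneOn p.coeff (Set.Iic m) ∧ AntitoneOn p.coeff (Set.Ici m) := by
  have key : ∃ m : ℤ, d - 1 ≤ 2 * m ∧ (∀ i < m, p.coeff i ≤ p.coeff (i + 1)) ∧
      (∀ i, m ≤ i → p.coeff (i + 1) ≤ p.coeff i) := by
    rcases h.middle with hm | hm
    -- The peak is the centre. The chain through the mirror index is `a_i ≤ a_{d-1-i} ≤ a_{i+1}`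
    -- left of it, and the reverse to its right.
    · refine ⟨d / 2, by lia, fun i hi => ?_, fun i hi => ?_⟩
      · exact (h.right i (d - 1 - i) (by lia) (by lia)).trans
          (hm (i + 1) (d - 1 - i) (by lia) (by lia))
      · exact (hm (d - 1 - i) (i + 1) (by lia) (by lia)).trans
          (h.right (d - 1 - i) i (by lia) (by lia))
    · refine ⟨(d + 1) / 2, by lia, fun i hi => ?_, fun i hi => ?_⟩
      · exact (hm i (d - i) (by lia) (by lia)).trans
          (h.left (i + 1) (d - i) (by lia) (by lia))
      · exact (h.left (d - i) (i + 1) (by lia) (by lia)).trans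
          (hm (d - i) i (by lia) (by lia))
  obtain ⟨m, hd, hinc, hdec⟩ := key
  refine ⟨m, hd, fun i _ j hj hij => ?_, fun i hi j _ hij => ?_⟩
  · revert hj
    induction j, hij using Int.leInduction with
    | base => exact fun _ => le_rfl
    | succ j _ ih =>
      intro hj
      rw [Set.mem_Iic] at hj
      exact (ih (Set.mem_Iic.2 (by lia))).trans (hinc j (by lia))
  · induction j, hij using Int.leInduction with
    | base => exact le_rfl
    | succ j hj ih => exact (hdec j (le_trans hi hj)).trans (ih (Set.mem_Ici.2 (le_trans hi hj)))

/-- Right of the peak this is monotonicity. Otherwise reflect `j` to `d + 1 - j ≤ i`, which only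
raises the coefficient, and climb from there to `i`. -/
theorem Interlacing.leftHeavy (h : Interlacing d p) (hc : d < c) : LeftHeavy c p := by
  obtain ⟨m, -, hinc, hdec⟩ := h.exists_peak
  intro i j hij hle
  rcases le_total m i with hi | hi
  · exact hdec hi (hi.trans hle) hle
  · exact (h.left (d + 1 - j) j (by lia) (by lia)).trans
      (hinc (Set.mem_Iic.2 (by lia)) hi (by lia))

theorem Interlacing.rightHeavy (h : Interlacing d p) (hc : c < d) : RightHeavy c p := by
  obtain ⟨m, -, hinc, hdec⟩ := h.exists_peak
  intro i j hij hle
  rcases le_total j m with hj | hj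
  · exact hinc (hle.trans hj) hj hle
  · exact (h.right i (d - 1 - i) (by lia) (by lia)).trans
      (hdec hj (Set.mem_Ici.2 (by lia)) (by lia))

theorem interlacing_one : Interlacing 0 1 := by
  have key : ∀ i : ℤ, (1 : ℤ[T;T⁻¹]).coeff i = if i = 0 then 1 else 0 := by
    intro i
    rw [← T_zero, T_apply]
    simp only [eq_comm]
  refine ⟨?_, ?_, Or.inl ?_⟩ <;> intro i j hij hle <;> simp only [key] <;> split_ifs <;> lia

/-- The polynomial is `T m` times an interlacing polynomial of degree at most `N - m`, `m ≥ 0`. -/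
def ShiftedInterlacing (N : ℤ) (p : ℤ[T;T⁻¹]) : Prop :=
  ∃ m : ℤ, 0 ≤ m ∧ ∃ r, Interlacing (N - m) r ∧ p = T m * r

theorem Interlacing.shifted (h : Interlacing d p) : ShiftedInterlacing d p :=
  ⟨0, le_rfl, p, by simpa using h, by simp⟩

theorem ShiftedInterlacing.T_mul (h : ShiftedInterlacing d p) :
    ShiftedInterlacing (d + 1) (T 1 * p) := by
  obtain ⟨m, hm, r, hr, rfl⟩ := h
  exact ⟨m + 1, by lia, r, by convert hr using 1; lia, by rw [← mul_assoc, ← T_add, add_comm]⟩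

theorem ShiftedInterlacing.rightHeavy (h : ShiftedInterlacing d p) (hc : c < d) :
    RightHeavy c p := by
  obtain ⟨m, hm, r, hr, rfl⟩ := h
  exact (hr.rightHeavy (by lia)).T_mul

/-! ### Transfer matrices -/

/-- The transfer matrix of an edge; the state `1` means that a node belongs to the ideal, and
`true` is an edge that goes up. -/
noncomputable def transfer (b : Bool) : Matrix (Fin 2) (Fin 2) ℤ[T;T⁻¹] :=
  if b then !![1, 0; 1, T 1] else !![1, T 1; 0, T 1]

/-- The product of the transfer matrices along a word. -/
noncomputable def wordMatrix (w : List Bool) : Matrix (Fin 2) (Fin 2) ℤ[T;T⁻¹] :=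
  (w.map transfer).prod

/-- The rank polynomial of the fence described by a word. -/
noncomputable def wordPoly (w : List Bool) : ℤ[T;T⁻¹] :=
  wordMatrix w 0 0 + wordMatrix w 0 1 + T 1 * (wordMatrix w 1 0 + wordMatrix w 1 1)

theorem wordMatrix_nil : wordMatrix [] = 1 := by simp [wordMatrix]

theorem wordMatrix_cons (b : Bool) (w : List Bool) :
    wordMatrix (b :: w) = transfer b * wordMatrix w := by simp [wordMatrix]

theorem wordMatrix_append (v w : List Bool) :
    wordMatrix (v ++ w) = wordMatrix v * wordMatrix w := by simp [wordMatrix]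

theorem wordMatrix_concat (w : List Bool) (b : Bool) :
    wordMatrix (w ++ [b]) = wordMatrix w * transfer b := by simp [wordMatrix]

/-- The polynomial matrix that intertwines the transfer matrices with their reciprocals. -/
noncomputable def intertwiner : Matrix (Fin 2) (Fin 2) ℤ[T;T⁻¹] :=
  !![T 1, 1 - T 1; T 1 - 1, 1]

theorem intertwiner_mul_transfer (b : Bool) :
    intertwiner * ((T 1 : ℤ[T;T⁻¹]) • (transfer b).map invert) = transfer b * intertwiner := by
  have hT : (T 1 : ℤ[T;T⁻¹]) * T (-1) = 1 := by rw [← T_add]; simp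
  apply Matrix.ext
  cases b <;> intro i j <;> fin_cases i <;> fin_cases j <;>
    simp [intertwiner, transfer, Matrix.mul_apply, Fin.sum_univ_two, hT] <;> ring

theorem intertwiner_mul_wordMatrix (w : List Bool) :
    intertwiner * ((T w.length : ℤ[T;T⁻¹]) • (wordMatrix w).map invert) =
      wordMatrix w * intertwiner := by
  induction w with
  | nil => simp [wordMatrix_nil]
  | cons b w ih =>
    have h : ((T (b :: w).length : ℤ[T;T⁻¹]) • (wordMatrix (b :: w)).map invert) =
        ((T 1 : ℤ[T;T⁻¹]) • (transfer b).map invert) *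
          ((T w.length : ℤ[T;T⁻¹]) • (wordMatrix w).map invert) := by
      rw [wordMatrix_cons, Matrix.map_mul, smul_mul_smul_comm, ← T_add, List.length_cons]
      push_cast
      rw [add_comm]
    rw [h, ← mul_assoc, intertwiner_mul_transfer, mul_assoc, ih, ← mul_assoc, wordMatrix_cons]

theorem intertwiner_det_ne_zero : intertwiner.det ≠ 0 := by
  intro h
  have h' := congrArg (fun p : ℤ[T;T⁻¹] => p.coeff 0) h
  have e : intertwiner.det = T 0 - T 1 + T 2 := by
    rw [intertwiner, Matrix.det_fin_two_of, T_zero, show (2 : ℤ) = 1 + 1 from rfl, T_add]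
    ring
  rw [e] at h'
  simp at h'

/-- The intertwiner makes the two matrices conjugate over the fraction field. Its determinant `1 - q
+ q²` is not a unit, so the adjugate replaces the inverse and the nonzero determinant is cancelled.
-/
theorem T_mul_invert_trace (w : List Bool) :
    T w.length * invert (wordMatrix w).trace = (wordMatrix w).trace := by
  have h := intertwiner_mul_wordMatrix w
  generalize hN : (T w.length : ℤ[T;T⁻¹]) • (wordMatrix w).map invert = N at h
  have hNt : N.trace = T w.length * invert (wordMatrix w).trace := by
    simp [← hN, Matrix.trace_fin_two, mul_add]
  rw [← hNt]
  apply mul_left_cancel₀ intertwiner_det_ne_zero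
  calc intertwiner.det * N.trace
      = (intertwiner.adjugate * (intertwiner * N)).trace := by
        rw [← mul_assoc, Matrix.adjugate_mul, Matrix.smul_mul, one_mul, Matrix.trace_smul,
          smul_eq_mul]
    _ = intertwiner.det * (wordMatrix w).trace := by
        rw [h, Matrix.trace_mul_comm, mul_assoc, Matrix.mul_adjugate, Matrix.mul_smul, mul_one,
          Matrix.trace_smul, smul_eq_mul]

/-- The rank polynomial of a circular fence is symmetric. -/
theorem isPalindromic_trace (w : List Bool) :
    IsPalindromic w.length (wordMatrix w).trace := by
  intro i j hij
  conv_lhs => rw [← T_mul_invert_trace w]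
  rw [coeff_T_mul, invert_apply]
  congr 1
  lia

/-! ### Rank polynomials of words -/

section Entries

variable (w : List Bool)

/-- The closing up edge, from last node to first, forbids exactly the ideals that contain the first
node but not the last. -/
theorem wordPoly_eq_trace_up :
    wordPoly w = (wordMatrix (w ++ [true])).trace + T 1 * wordMatrix w 1 0 := by
  simp only [wordPoly, wordMatrix_concat, transfer, Matrix.trace_fin_two, Matrix.mul_apply,
    Fin.sum_univ_two]
  simp
  ring

theorem wordPoly_eq_trace_down :
    wordPoly w = (wordMatrix (w ++ [false])).trace + wordMatrix w 0 1 := by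
  simp only [wordPoly, wordMatrix_concat, transfer, Matrix.trace_fin_two, Matrix.mul_apply,
    Fin.sum_univ_two]
  simp
  ring

/-- The two extra edges add a node above both ends; an ideal containing it must contain both ends.
-/
theorem wordPoly_add_eq_trace :
    wordPoly w + T 2 * wordMatrix w 1 1 = (wordMatrix (w ++ [true, false])).trace := by
  simp only [wordPoly, wordMatrix_append, wordMatrix_cons, wordMatrix_nil, transfer,
    Matrix.trace_fin_two, Matrix.mul_apply, Fin.sum_univ_two, show (2 : ℤ) = 1 + 1 from rfl, T_add]
  simp
  ring

/-- Here the extra node lies below both ends; an ideal avoiding it must avoid both. -/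
theorem T_mul_wordPoly_add_eq_trace :
    T 1 * wordPoly w + wordMatrix w 0 0 = (wordMatrix (w ++ [false, true])).trace := by
  simp only [wordPoly, wordMatrix_append, wordMatrix_cons, wordMatrix_nil, transfer,
    Matrix.trace_fin_two, Matrix.mul_apply, Fin.sum_univ_two]
  simp
  ring

/-- Rank polynomial of the ideals that avoid the first node. -/
noncomputable def avoidFirst : ℤ[T;T⁻¹] := wordMatrix w 0 0 + wordMatrix w 0 1

/-- Rank polynomial of the ideals that contain the first node, which is not counted. -/
noncomputable def containFirst : ℤ[T;T⁻¹] := wordMatrix w 1 0 + wordMatrix w 1 1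

/-- Rank polynomial of the ideals that avoid the last node. -/
noncomputable def avoidLast : ℤ[T;T⁻¹] := wordMatrix w 0 0 + T 1 * wordMatrix w 1 0

/-- Rank polynomial of the ideals that contain the last node. -/
noncomputable def containLast : ℤ[T;T⁻¹] := wordMatrix w 0 1 + T 1 * wordMatrix w 1 1

end Entries

/-- All words of length less than `N` have interlacing rank polynomials. -/
def InterlacingBelow (N : ℕ) : Prop :=
  ∀ w : List Bool, w.length < N → Interlacing (w.length + 1) (wordPoly w)

/-! ### Fences with prescribed end nodes -/

theorem InterlacingBelow.mono {M N : ℕ} (h : InterlacingBelow N) (hMN : M ≤ N) :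
    InterlacingBelow M := fun w hw => h w (hw.trans_le hMN)

/-- Avoiding the first node excludes the whole initial up run; the first down edge then frees the
rest, a shorter fence. -/
theorem avoidFirst_leftHeavy (w : List Bool) (h : InterlacingBelow w.length) (hc : w.length < c) :
    LeftHeavy c (avoidFirst w) := by
  induction w with
  | nil =>
    have : avoidFirst [] = 1 := by simp [avoidFirst, wordMatrix_nil]
    rw [this]
    exact interlacing_one.leftHeavy (by simpa using hc)
  | cons b w ih =>
    rw [List.length_cons] at h
    rw [List.length_cons] at hc
    push_cast at hc
    cases b with
    | true =>
      have : avoidFirst (true :: w) = avoidFirst w := by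
        simp [avoidFirst, wordMatrix_cons, transfer, Matrix.mul_apply, Fin.sum_univ_two]
      rw [this]
      exact ih (h.mono (by lia)) (by lia)
    | false =>
      have : avoidFirst (false :: w) = wordPoly w := by
        simp [avoidFirst, wordPoly, wordMatrix_cons, transfer, Matrix.mul_apply,
          Fin.sum_univ_two]
        ring
      rw [this]
      exact (h w (by lia)).leftHeavy hc

theorem avoidLast_leftHeavy (w : List Bool) (h : InterlacingBelow w.length) (hc : w.length < c) :
    LeftHeavy c (avoidLast w) := by
  induction w using List.reverseRecOn with
  | nil =>
    have : avoidLast [] = 1 := by simp [avoidLast, wordMatrix_nil]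
    rw [this]
    exact interlacing_one.leftHeavy (by simpa using hc)
  | append_singleton w b ih =>
    rw [List.length_append, List.length_singleton] at h
    rw [List.length_append, List.length_singleton] at hc
    push_cast at hc
    cases b with
    | false =>
      have : avoidLast (w ++ [false]) = avoidLast w := by
        simp [avoidLast, wordMatrix_concat, transfer, Matrix.mul_apply, Fin.sum_univ_two]
      rw [this]
      exact ih (h.mono (by lia)) (by lia)
    | true =>
      have : avoidLast (w ++ [true]) = wordPoly w := by
        simp [avoidLast, wordPoly, wordMatrix_concat, transfer, Matrix.mul_apply,
          Fin.sum_univ_two]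
      rw [this]
      exact (h w (by lia)).leftHeavy hc

theorem wordMatrix_zero_zero_leftHeavy (w : List Bool) (h : InterlacingBelow w.length)
    (hc : w.length < c) : LeftHeavy c (wordMatrix w 0 0) := by
  induction w using List.reverseRecOn with
  | nil =>
    have : wordMatrix [] 0 0 = 1 := by simp [wordMatrix_nil]
    rw [this]
    exact interlacing_one.leftHeavy (by simpa using hc)
  | append_singleton w b ih =>
    rw [List.length_append, List.length_singleton] at h
    rw [List.length_append, List.length_singleton] at hc
    push_cast at hc
    cases b with
    | false =>
      have : wordMatrix (w ++ [false]) 0 0 = wordMatrix w 0 0 := by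
        simp [wordMatrix_concat, transfer, Matrix.mul_apply, Fin.sum_univ_two]
      rw [this]
      exact ih (h.mono (by lia)) (by lia)
    | true =>
      have : wordMatrix (w ++ [true]) 0 0 = avoidFirst w := by
        simp [avoidFirst, wordMatrix_concat, transfer, Matrix.mul_apply, Fin.sum_univ_two]
      rw [this]
      exact avoidFirst_leftHeavy w (h.mono (by lia)) (by lia)

/-- Containing the first node forces the initial down run. Each forced node contributes a factor
`q`, whence the shift. -/
theorem containFirst_shifted (w : List Bool) (h : InterlacingBelow w.length) :
    ShiftedInterlacing w.length (containFirst w) := by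
  induction w with
  | nil =>
    have : containFirst [] = 1 := by simp [containFirst, wordMatrix_nil]
    rw [this]
    exact interlacing_one.shifted
  | cons b w ih =>
    rw [List.length_cons] at h ⊢
    push_cast
    cases b with
    | true =>
      have : containFirst (true :: w) = wordPoly w := by
        simp [containFirst, wordPoly, wordMatrix_cons, transfer, Matrix.mul_apply,
          Fin.sum_univ_two]
        ring
      rw [this]
      exact (h w (by lia)).shifted
    | false =>
      have : containFirst (false :: w) = T 1 * containFirst w := by
        simp [containFirst, wordMatrix_cons, transfer, Matrix.mul_apply, Fin.sum_univ_two]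
        ring
      rw [this]
      exact (ih (h.mono (by lia))).T_mul

theorem containLast_eq (w : List Bool) (h : InterlacingBelow w.length) :
    ∃ r, ShiftedInterlacing w.length r ∧ containLast w = T 1 * r := by
  induction w using List.reverseRecOn with
  | nil =>
    exact ⟨1, interlacing_one.shifted, by simp [containLast, wordMatrix_nil]⟩
  | append_singleton w b ih =>
    rw [List.length_append, List.length_singleton] at h ⊢
    push_cast
    cases b with
    | true =>
      obtain ⟨r, hr, e⟩ := ih (h.mono (by lia))
      refine ⟨T 1 * r, hr.T_mul, ?_⟩
      rw [← e]
      simp only [containLast, wordMatrix_concat, transfer, Matrix.mul_apply, Fin.sum_univ_two]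
      generalize (T 1 : ℤ[T;T⁻¹]) = q
      simp
      ring
    | false =>
      refine ⟨wordPoly w, (h w (by lia)).shifted, ?_⟩
      simp [containLast, wordPoly, wordMatrix_concat, transfer, Matrix.mul_apply,
        Fin.sum_univ_two]
      ring

theorem wordMatrix_one_one_shifted (w : List Bool) (h : InterlacingBelow w.length) :
    ShiftedInterlacing w.length (wordMatrix w 1 1) := by
  induction w using List.reverseRecOn with
  | nil =>
    have : wordMatrix [] 1 1 = 1 := by simp [wordMatrix_nil]
    rw [this]
    exact interlacing_one.shifted
  | append_singleton w b ih =>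
    rw [List.length_append, List.length_singleton] at h ⊢
    push_cast
    cases b with
    | true =>
      have : wordMatrix (w ++ [true]) 1 1 = T 1 * wordMatrix w 1 1 := by
        simp [wordMatrix_concat, transfer, Matrix.mul_apply, Fin.sum_univ_two]
      rw [this]
      exact (ih (h.mono (by lia))).T_mul
    | false =>
      have : wordMatrix (w ++ [false]) 1 1 = T 1 * containFirst w := by
        simp [containFirst, wordMatrix_concat, transfer, Matrix.mul_apply, Fin.sum_univ_two]
        ring
      rw [this]
      exact (containFirst_shifted w (h.mono (by lia))).T_mul

/-! ### The middle inequality and the induction -/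

theorem wordPoly_leftHeavy_of_up (w : List Bool)
    (h : LeftHeavy (w.length + 1) (T 1 * wordMatrix w 1 0)) :
    LeftHeavy (w.length + 1) (wordPoly w) := by
  rw [wordPoly_eq_trace_up]
  exact IsPalindromic.leftHeavy_add (by simpa using isPalindromic_trace (w ++ [true])) h

theorem wordPoly_rightHeavy_of_up (w : List Bool)
    (h : RightHeavy (w.length + 1) (T 1 * wordMatrix w 1 0)) :
    RightHeavy (w.length + 1) (wordPoly w) := by
  rw [wordPoly_eq_trace_up]
  exact IsPalindromic.rightHeavy_add (by simpa using isPalindromic_trace (w ++ [true])) h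

theorem wordPoly_leftHeavy_of_down (w : List Bool)
    (h : LeftHeavy (w.length + 1) (wordMatrix w 0 1)) :
    LeftHeavy (w.length + 1) (wordPoly w) := by
  rw [wordPoly_eq_trace_down]
  exact IsPalindromic.leftHeavy_add (by simpa using isPalindromic_trace (w ++ [false])) h

theorem wordPoly_rightHeavy_of_down (w : List Bool)
    (h : RightHeavy (w.length + 1) (wordMatrix w 0 1)) :
    RightHeavy (w.length + 1) (wordPoly w) := by
  rw [wordPoly_eq_trace_down]
  exact IsPalindromic.rightHeavy_add (by simpa using isPalindromic_trace (w ++ [false])) h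

/-- The first and last edges decide. If they agree, a suitable closing edge leaves the inner fence,
up to a power of `q`, as discrepancy, and its dichotomy is inherited. If they differ, the
discrepancy has a prescribed end and leans a definite way. -/
theorem wordPoly_middle (w : List Bool) (h : InterlacingBelow w.length) :
    LeftHeavy (w.length + 1) (wordPoly w) ∨ RightHeavy (w.length + 1) (wordPoly w) := by
  have zero : ∀ c, LeftHeavy c 0 := fun c i j _ _ => le_rfl
  rcases w with _ | ⟨b, w⟩
  · exact Or.inl (wordPoly_leftHeavy_of_up _ (by simpa [wordMatrix_nil] using zero _))
  rcases List.eq_nil_or_concat w with rfl | ⟨w, e, rfl⟩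
  · left
    apply wordPoly_leftHeavy_of_up
    cases b
    · simpa [wordMatrix_cons, wordMatrix_nil, transfer] using zero _
    · intro i j hij hle
      simp [wordMatrix_cons, wordMatrix_nil, transfer] at hij ⊢
      split_ifs <;> lia
  have hlen : (b :: (w ++ [e])).length = w.length + 2 := by simp
  rw [List.concat_eq_append] at *
  rw [hlen] at h
  have hw := h w (by lia)
  cases b <;> cases e
  · have e1 : wordMatrix (false :: (w ++ [false])) 0 1 = T 1 * wordPoly w := by
      simp [wordPoly, wordMatrix_cons, wordMatrix_concat, transfer, Matrix.mul_apply,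
        Fin.sum_univ_two]
      ring
    refine hw.middle.imp (fun hm => wordPoly_leftHeavy_of_down _ ?_)
      (fun hm => wordPoly_rightHeavy_of_down _ ?_)
    · rw [e1, hlen]
      apply LeftHeavy.T_mul
      convert hm using 1
      push_cast
      ring
    · rw [e1, hlen]
      apply RightHeavy.T_mul
      convert hm using 1
      push_cast
      ring
  · right
    have e1 : wordMatrix (false :: (w ++ [true])) 0 1 = T 1 * containLast w := by
      simp only [containLast, wordMatrix_cons, wordMatrix_concat, transfer, Matrix.mul_apply,
        Fin.sum_univ_two]
      generalize (T 1 : ℤ[T;T⁻¹]) = q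
      simp
      ring
    obtain ⟨r, hr, e2⟩ := containLast_eq w (h.mono (by lia))
    apply wordPoly_rightHeavy_of_down
    rw [e1, e2, hlen]
    exact (hr.rightHeavy (by push_cast; lia)).T_mul.T_mul
  · left
    have e1 : wordMatrix (true :: (w ++ [false])) 1 0 = avoidLast w := by
      simp [avoidLast, wordMatrix_cons, wordMatrix_concat, transfer, Matrix.mul_apply,
        Fin.sum_univ_two]
    apply wordPoly_leftHeavy_of_up
    rw [e1, hlen]
    exact (avoidLast_leftHeavy w (h.mono (by lia)) (by push_cast; lia)).T_mul
  · have e1 : wordMatrix (true :: (w ++ [true])) 1 0 = wordPoly w := by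
      simp [wordPoly, wordMatrix_cons, wordMatrix_concat, transfer, Matrix.mul_apply,
        Fin.sum_univ_two]
    refine hw.middle.imp (fun hm => wordPoly_leftHeavy_of_up _ ?_)
      (fun hm => wordPoly_rightHeavy_of_up _ ?_)
    · rw [e1, hlen]
      apply LeftHeavy.T_mul
      convert hm using 1
      push_cast
      ring
    · rw [e1, hlen]
      apply RightHeavy.T_mul
      convert hm using 1
      push_cast
      ring

theorem interlacing_wordPoly (w : List Bool) : Interlacing (w.length + 1) (wordPoly w) := by
  induction hn : w.length using Nat.strong_induction_on generalizing w with
  | _ n ih =>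
  subst hn
  have h : InterlacingBelow w.length := fun v hv => ih _ hv v rfl
  refine ⟨?_, ?_, wordPoly_middle w h⟩
  · have := isPalindromic_trace (w ++ [true, false])
    rw [← wordPoly_add_eq_trace] at this
    simp only [List.length_append, List.length_cons, List.length_nil] at this
    refine IsPalindromic.leftHeavy_of_add (r := T 2 * wordMatrix w 1 1)
      (by convert this using 1; push_cast; ring) ?_
    exact ((wordMatrix_one_one_shifted w h).rightHeavy (by lia)).T_mul
  · have := isPalindromic_trace (w ++ [false, true])
    rw [← T_mul_wordPoly_add_eq_trace] at this
    simp only [List.length_append, List.length_cons, List.length_nil] at this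
    refine RightHeavy.of_T_mul (k := 1) (IsPalindromic.rightHeavy_of_add
      (by convert this using 1; push_cast; ring) ?_)
    exact wordMatrix_zero_zero_leftHeavy w h (by lia)

/-! ### Ideals as paths of states -/

theorem sum_path_eq {κ R : Type*} [Fintype κ] [DecidableEq κ] [CommSemiring R] {n : ℕ}
    (A : Fin n → Matrix κ κ R) (g : κ → R) :
    ∑ s : Fin (n + 1) → κ, g (s 0) * ∏ i, A i (s i.castSucc) (s i.succ) =
      ∑ a, g a * ∑ b, (List.ofFn A).prod a b := by
  induction n generalizing g with
  | zero =>
    rw [← (Equiv.funUnique (Fin 1) κ).symm.sum_comp]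
    simp [Matrix.one_apply]
  | succ n ih =>
    rw [← (Fin.consEquiv fun _ => κ).sum_comp, Fintype.sum_prod_type]
    refine Finset.sum_congr rfl fun a _ => ?_
    -- The first step of the path is absorbed into the initial weight.
    have := ih (fun i => A i.succ) (fun c => g a * A 0 a c)
    simp only [Fin.consEquiv_apply, Fin.prod_univ_succ, Fin.cons_zero, Fin.castSucc_zero,
      Fin.cons_succ, ← Fin.succ_castSucc, ← mul_assoc]
    rw [this, List.ofFn_succ, List.prod_cons]
    simp only [Matrix.mul_apply, Finset.mul_sum]
    rw [Finset.sum_comm]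
    simp only [mul_assoc]

theorem transfer_apply (b : Bool) (x y : Fin 2) :
    transfer b x y = (if (if b then y ≤ x else x ≤ y) then 1 else 0) * T ((y : ℕ) : ℤ) := by
  cases b <;> fin_cases x <;> fin_cases y <;> simp [transfer]

theorem wordPoly_ofFn {n : ℕ} (w : Fin n → Bool) :
    wordPoly (List.ofFn w) = ∑ s : Fin (n + 1) → Fin 2,
      (if ∀ i : Fin n, if w i then s i.succ ≤ s i.castSucc else s i.castSucc ≤ s i.succ
        then T ((∑ j, (s j : ℕ) : ℕ) : ℤ) else 0) := by
  have h := sum_path_eq (fun i => transfer (w i)) (fun a : Fin 2 => (T ((a : ℕ) : ℤ) : ℤ[T;T⁻¹]))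
  have e : wordPoly (List.ofFn w) = ∑ a : Fin 2, (T ((a : ℕ) : ℤ) : ℤ[T;T⁻¹]) *
      ∑ b, (List.ofFn fun i => transfer (w i)).prod a b := by
    simp [wordPoly, wordMatrix, Fin.sum_univ_two, List.map_ofFn, Function.comp_def]
  rw [e, ← h]
  refine Finset.sum_congr rfl fun s _ => ?_
  have hT : ∀ (m : ℕ) (f : Fin m → ℕ),
      ∏ i, (T (f i : ℤ) : ℤ[T;T⁻¹]) = T ((∑ i, f i : ℕ) : ℤ) := by
    intro m f
    induction m with
    | zero => simp
    | succ m ih => rw [Fin.prod_univ_succ, ih, ← T_add, Fin.sum_univ_succ]; push_cast; rfl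
  simp only [transfer_apply, Finset.prod_mul_distrib]
  rw [Finset.prod_boole, hT, mul_left_comm, ← T_add, Fin.sum_univ_succ]
  push_cast
  simp only [Finset.mem_univ, forall_const, ite_mul, one_mul, zero_mul]

end FenceWord

/-! ### From words back to fence posets -/

open FenceWord LaurentPolynomial in
theorem toLaurent_rankPolynomial_fence {n : ℕ} (α : Composition n) :
    ((rankPolynomial (Fence α)).map (Nat.castRingHom ℤ)).toLaurent =
      wordPoly (List.ofFn fun i : Fin n => decide (Even (α.index i : ℕ))) := by
  classical
  rw [wordPoly_ofFn, rankPolynomial, Polynomial.map_sum, map_sum]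
  -- Ideals correspond to their indicator functions, which are the state sequences that decrease
  -- along every relation.
  let e : LowerSet (Fence α) → Fin (n + 1) → Fin 2 :=
    fun I j => if Fence.node α j ∈ I then 1 else 0
  refine Finset.sum_of_injOn e ?_ (by simp) ?_ ?_
  · intro I _ J _ h
    ext x
    have := congrFun h x
    simp only [e] at this
    change Fence.node α x ∈ I ↔ Fence.node α x ∈ J
    split_ifs at this <;> simp_all
  · intro s _ hs
    refine if_neg fun hall => hs ?_
    have hstep : ∀ x y : Fence α, Fence.Step α x y → s y ≤ s x := by
      intro x y hxy
      cases hxy with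
      | up i h =>
        have := hall i
        rw [if_pos (by simpa using h)] at this
        exact this
      | down i h =>
        have := hall i
        rw [if_neg (by simpa using h)] at this
        exact this
    have hle : ∀ x y : Fence α, x ≤ y → s y ≤ s x := by
      intro x y hxy
      change Relation.ReflTransGen (Fence.Step α) x y at hxy
      induction hxy with
      | refl => exact le_rfl
      | tail _ hs ih => exact (hstep _ _ hs).trans ih
    refine ⟨⟨{x | s x = 1}, fun a b hba ha => ?_⟩, by simp, ?_⟩
    · have := hle _ _ hba
      simp only [Set.mem_ofPred_eq] at ha ⊢
      rw [ha] at this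
      exact le_antisymm (Fin.le_last _) this
    · funext j
      have : ∀ a : Fin 2, (if a = 1 then 1 else 0) = a := by decide
      refine Eq.trans ?_ (this (s j))
      simp only [e]
      congr 1
  · intro I _
    have hall : ∀ i : Fin n, if decide (Even (α.index i : ℕ)) = true
        then e I i.succ ≤ e I i.castSucc else e I i.castSucc ≤ e I i.succ := by
      have hle : ∀ x y : Fence α, Fence.Step α x y → e I y ≤ e I x := by
        intro x y hxy
        have : y ∈ I → x ∈ I := fun hy => I.lower (Relation.ReflTransGen.single hxy) hy
        change (if y ∈ I then (1 : Fin 2) else 0) ≤ if x ∈ I then 1 else 0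
        split_ifs <;> simp_all
      intro i
      split_ifs with h
      · exact hle _ _ (Fence.Step.up i (by simpa using h))
      · exact hle _ _ (Fence.Step.down i (by simpa using h))
    rw [if_pos hall]
    have hcard : (I : Set (Fence α)).ncard = ∑ j, (e I j : ℕ) := by
      have : ∀ j, ((e I j : Fin 2) : ℕ) = if Fence.node α j ∈ I then 1 else 0 := by
        intro j
        simp only [e]
        split_ifs <;> rfl
      simp only [this]
      rw [Finset.sum_boole, Nat.cast_id, ← Set.ncard_coe_finset]
      congr 1
      ext x
      exact (Finset.mem_filter_univ (α := Fin (n + 1)) (p := fun j => Fence.node α j ∈ I) x).symm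
    rw [hcard]
    simp

theorem mainTheorem2 {n : ℕ} (α : Composition n) :
    (rankPolynomial (Fence α)).IsUnimodal := by
  obtain ⟨m, hm, hinc, hdec⟩ := (FenceWord.interlacing_wordPoly
    (List.ofFn fun i : Fin n => decide (Even (α.index i : ℕ)))).exists_peak
  rw [List.length_ofFn] at hm
  have hcoeff : ∀ i : ℕ, ((rankPolynomial (Fence α)).coeff i : ℤ) =
      (FenceWord.wordPoly (List.ofFn fun i : Fin n => decide (Even (α.index i : ℕ)))).coeff i := by
    intro i
    rw [← toLaurent_rankPolynomial_fence, LaurentPolynomial.coeff_toLaurent]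
    refine (Eq.trans (Finsupp.mapDomain_apply Nat.cast_injective _ i) ?_).symm
    exact Polynomial.coeff_map _ i
  lift m to ℕ using by lia
  -- Capping the peak at the degree avoids having to compute the degree.
  refine ⟨min m (rankPolynomial (Fence α)).natDegree, min_le_right _ _, fun i hi => ?_,
    fun i hi hid => ?_⟩
  · have := hinc (a := (i : ℤ)) (b := ((i + 1 : ℕ) : ℤ)) (Set.mem_Iic.2 (by lia))
      (Set.mem_Iic.2 (by lia)) (by lia)
    rw [← hcoeff, ← hcoeff] at this
    exact_mod_cast this
  · have := hdec (a := (i : ℤ)) (b := ((i + 1 : ℕ) : ℤ)) (Set.mem_Ici.2 (by lia))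
      (Set.mem_Ici.2 (by lia)) (by lia)
    rw [← hcoeff, ← hcoeff] at this
    exact_mod_cast this
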